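/- Let $G$ be a virtually abelian group, that is, a group with an abelian subgroup of finite index. Let $S\subseteq G$ be a finite set that generates $G$ as a monoid, and let $\omega\colon S\to\{1,2,3,\ldots\}$ assign a positive integer weight to each generator. For a word $\sigma=\sigma_1\sigma_2\cdots\sigma_m\in S^*$, write $\overline{\sigma}\in G$ for the group element it represents and $\omega(\sigma)=\omega(\sigma_1)+\cdots+\omega(\sigma_m)$ for its weight; $\sigma$ is a geodesic if $\omega(\sigma)=\min\{\omega(\tau) : \tau\in S^*,\ \overline{\tau}=\overline{\sigma}\}$. A blind $k$-counter automaton over a finite alphabet $\Sigma$ consists of a finite set $Q$ of states, an initial state $q_0\in Q$, a set $F\subseteq Q$ of final states, and a finite transition relation $\delta\subseteq (Q\times(\Sigma\cup\{\varepsilon,\mathfrak{e}\}))\times(Q\times\mathbb{Z}^k)$, where $\mathfrak{e}\notin\Sigma$ is an end of tape symbol. Its configurations are triples $(q,c,\sigma\mathfrak{e})$ with $q\in Q$, $c\in\mathbb{Z}^k$ and $\sigma\in\Sigma^*$. A transition $((q,s),(p,v))\in\delta$ with $s\in\Sigma\cup\{\varepsilon\}$ allows the moves $(q,c,s\sigma'\mathfrak{e})\vdash(p,c+v,\sigma'\mathfrak{e})$,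 and a transition $((q,\mathfrak{e}),(p,v))\in\delta$ allows the moves $(q,c,\mathfrak{e})\vdash(p,c+v,\mathfrak{e})$. The automaton accepts $\sigma\in\Sigma^*$ if some finite (possibly empty) sequence of moves leads from $(q_0,0,\sigma\mathfrak{e})$ to $(q,0,\mathfrak{e})$ for some $q\in F$. Theorem. There are $k\in\mathbb{N}$ and a blind $k$-counter automaton over the alphabet $S$ that accepts precisely the words $\sigma\in S^*$ that are geodesics; that is, the language of geodesics of $G$ with respect to $S$ and $\omega$ is blind multicounter. -/

import Mathlib

/-- A group is virtually abelian if it has an abelian subgroup of finite index. -/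
def IsVirtuallyAbelian (G : Type*) [Group G] : Prop :=
  ∃ A : Subgroup G, A.FiniteIndex ∧ ∀ x ∈ A, ∀ y ∈ A, x * y = y * x

namespace WeightedWord

variable {G : Type*} [Group G] {S : Finset G}

/-- The group element represented by a word in the letters of `S`. -/
def value (σ : List S) : G :=
  (σ.map (fun s => (s : G))).prod

/-- The weight of a word: the sum of the weights of its letters. -/
def weight (ω : S → ℕ) (σ : List S) : ℕ :=
  (σ.map ω).sum

/-- The weighted length of a group element: the minimal weight of a word representing it.
(The infimum is a minimum whenever `g` is represented by some word, hence for every `g` when `S`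
generates the group as a monoid.) -/
noncomputable def weightedLength (ω : S → ℕ) (g : G) : ℕ :=
  sInf {n : ℕ | ∃ σ : List S, value σ = g ∧ weight ω σ = n}

/-- A word is a geodesic if it has minimal weight among the words representing the same element. -/
def IsGeodesic (ω : S → ℕ) (σ : List S) : Prop :=
  weight ω σ = weightedLength ω (value σ)

/-- The language of geodesics over the alphabet `S`. -/
def geodesicLanguage (ω : S → ℕ) : Language S :=
  {σ | IsGeodesic ω σ}

end WeightedWord

/-- The possible labels `Σ ∪ {ε, 𝔢}` of a transition: a letter of the alphabet, the empty word,
or the end of tape symbol. -/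
inductive InputLabel (α : Type*) where
  | letter (a : α)
  | empty
  | endOfTape

/-- A blind `k`-counter automaton with finite input alphabet `α` and finite set of states `Q`. -/
structure BlindCounterAutomaton (k : ℕ) (α : Type*) (Q : Type*) where
  finite_alphabet : Finite α
  finite_states : Finite Q
  /-- The transition relation. -/
  δ : Set ((Q × InputLabel α) × (Q × (Fin k → ℤ)))
  finite_δ : δ.Finite
  /-- The initial state. -/
  start : Q
  /-- The set of final states. -/
  final : Set Q

namespace BlindCounterAutomaton

variable {k : ℕ} {α Q : Type*}

/-- An instantaneous description `(q, (c₁, …, c_k), σ𝔢)`: the current state, the values of the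
counters, and the word `σ` of letters not consumed yet. The end of tape symbol always follows
`σ` and is never consumed, so that it is left implicit. -/
structure Config (k : ℕ) (α Q : Type*) where
  state : Q
  counters : Fin k → ℤ
  input : List α

/-- One move of the automaton. A transition labelled by a letter consumes that letter, an
`ε`-transition consumes nothing, and a transition labelled by the end of tape symbol can be used
only when all the letters are consumed, and does not consume the end of tape symbol. -/
inductive Step (M : BlindCounterAutomaton k α Q) : Config k α Q → Config k α Q → Prop
  | letter (q p : Q) (v c : Fin k → ℤ) (a : α) (σ : List α)
      (h : ((q, InputLabel.letter a), (p, v)) ∈ M.δ) :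
      Step M ⟨q, c, a :: σ⟩ ⟨p, c + v, σ⟩
  | empty (q p : Q) (v c : Fin k → ℤ) (σ : List α)
      (h : ((q, InputLabel.empty), (p, v)) ∈ M.δ) :
      Step M ⟨q, c, σ⟩ ⟨p, c + v, σ⟩
  | endOfTape (q p : Q) (v c : Fin k → ℤ)
      (h : ((q, InputLabel.endOfTape), (p, v)) ∈ M.δ) :
      Step M ⟨q, c, []⟩ ⟨p, c + v, []⟩

/-- The automaton can pass from one configuration to another in finitely many moves. -/
def Reaches (M : BlindCounterAutomaton k α Q) : Config k α Q → Config k α Q → Prop :=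
  Relation.ReflTransGen M.Step

/-- The language of the automaton: the words from which it can reach a final state with all the
letters consumed and with zero on all its counters. -/
def language (M : BlindCounterAutomaton k α Q) : Language α :=
  {σ | ∃ q ∈ M.final, M.Reaches ⟨M.start, 0, σ⟩ ⟨q, 0, []⟩}

end BlindCounterAutomaton

/-- A language is blind multicounter if it is the language of a blind `k`-counter automaton for
some `k`. -/
def IsBlindMulticounter {α : Type*} (L : Language α) : Prop :=
  ∃ (k : ℕ) (Q : Type) (M : BlindCounterAutomaton k α Q), M.language = L

/-! Let `N` be the normal core of the abelian subgroup: it is abelian, normal and of finite index.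
Reading a word while tracking its coset in `G ⧸ N`, and emitting at each letter the Schreier element
of `N`, gives a finite transducer whose last state and total output determine the value of the word,
and conversely. Adjoin the weight to the output. The outputs of words ending in state `q` form a
semilinear set `R q` (Parikh), and a word is geodesic iff its output avoids `R q + {0} × ℕ_{>0}`,
the outputs beaten by a cheaper word. Semilinear sets are closed under sums and differences, so
geodesics are the words whose output lies in a semilinear set depending on the last state. Blind
counters test this: they count the transitions used, and at the end of tape the automaton guesses a
base and periods to subtract. -/

open Pointwise

/-! ### Walks with semilinear labels -/

/-- The labels of the nonempty walks from `p` to `q` all of whose intermediate vertices lie in `X`,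
where `E p q` is the set of labels of the edges from `p` to `q`, and labels are added up. -/
inductive LabelledWalk {Q M : Type*} [AddCommMonoid M] (E : Q → Q → Set M) (X : Set Q) :
    Q → Q → M → Prop
  | single {p q : Q} {m : M} (h : m ∈ E p q) : LabelledWalk E X p q m
  | cons {p r q : Q} {m m' : M} (h : m ∈ E p r) (hr : r ∈ X) (h' : LabelledWalk E X r q m') :
      LabelledWalk E X p q (m + m')

namespace LabelledWalk

variable {Q M : Type*} [AddCommMonoid M] {E : Q → Q → Set M} {X Y : Set Q} {p q x : Q} {m m' : M}

theorem mono (hXY : X ⊆ Y) (h : LabelledWalk E X p q m) : LabelledWalk E Y p q m := by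
  induction h with
  | single h => exact single h
  | cons h hr _ ih => exact cons h (hXY hr) ih

theorem append (hx : x ∈ X) (h : LabelledWalk E X p x m) (h' : LabelledWalk E X x q m') :
    LabelledWalk E X p q (m + m') := by
  induction h with
  | single h => exact cons h hx h'
  | cons h hr _ ih => rw [add_assoc]; exact cons h hr (ih hx h')

theorem closure_append (hx : x ∈ X) (h : m ∈ AddSubmonoid.closure {m | LabelledWalk E X x x m})
    (h' : LabelledWalk E X x q m') : LabelledWalk E X x q (m + m') := by
  induction h using AddSubmonoid.closure_induction generalizing m' with
  | mem m hm => exact append hx hm h'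
  | zero => rwa [zero_add]
  | add a b _ _ iha ihb => rw [add_assoc]; exact iha (ihb h')

/-- Cut a walk at its visits to `x`: a part before the first visit, loops at `x`, and a part after
the last. -/
theorem setOf_insert (E : Q → Q → Set M) (X : Set Q) (p q x : Q) :
    {m | LabelledWalk E (insert x X) p q m} = {m | LabelledWalk E X p q m} ∪
      ({m | LabelledWalk E X p x m} + (AddSubmonoid.closure {m | LabelledWalk E X x x m} : Set M) +
        {m | LabelledWalk E X x q m}) := by
  ext m
  constructor
  · intro h
    change LabelledWalk E (insert x X) p q m at h
    induction h with
    | single h => exact Or.inl (single h)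
    | @cons p r q m m' h hr _ ih =>
      rcases hr with rfl | hr
      · rcases ih with ih | ⟨_, ⟨m₁, h₁, m₂, h₂, rfl⟩, m₃, h₃, rfl⟩
        · exact Or.inr ⟨m, ⟨m, single h, 0, zero_mem _, add_zero m⟩, m', ih, rfl⟩
        · exact Or.inr ⟨m + (m₁ + m₂), ⟨m, single h, m₁ + m₂,
            add_mem (AddSubmonoid.subset_closure h₁) h₂, rfl⟩, m₃, h₃, add_assoc _ _ _⟩
      · rcases ih with ih | ⟨_, ⟨m₁, h₁, m₂, h₂, rfl⟩, m₃, h₃, rfl⟩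
        · exact Or.inl (cons h hr ih)
        · exact Or.inr ⟨m + m₁ + m₂, ⟨m + m₁, cons h hr h₁, m₂, h₂, rfl⟩, m₃, h₃, by
            simp only [add_assoc]⟩
  · have hX : X ⊆ insert x X := Set.subset_insert x X
    rintro (h | ⟨_, ⟨m₁, h₁, m₂, h₂, rfl⟩, m₃, h₃, rfl⟩)
    · exact mono hX h
    · change LabelledWalk E (insert x X) p q (m₁ + m₂ + m₃)
      rw [add_assoc]
      refine append (Set.mem_insert x X) (mono hX h₁)
        (closure_append (Set.mem_insert x X) ?_ (mono hX h₃))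
      exact AddSubmonoid.closure_mono (fun _ => mono hX) h₂

/-- Kleene's argument: the walk labels form semilinear sets if the edge labels do. -/
theorem isSemilinearSet (hE : ∀ p q, IsSemilinearSet (E p q)) (hX : X.Finite) (p q : Q) :
    IsSemilinearSet {m | LabelledWalk E X p q m} := by
  induction X, hX using Set.Finite.induction_on generalizing p q with
  | empty =>
    convert hE p q using 1
    ext m
    refine ⟨fun h => ?_, single⟩
    cases h with
    | single h => exact h
    | cons _ hr _ => exact hr.elim
  | @insert x X _ _ ih =>
    rw [setOf_insert]
    exact (ih p q).union (((ih p x).add (ih x x).closure).add (ih x q))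

end LabelledWalk

/-! ### Transducers and Parikh's theorem -/

/-- The sum of the outputs of a deterministic transducer that reads a word from the state `q`. -/
def transducerOutput {Q α M : Type*} [AddCommMonoid M] (step : Q → α → Q) (out : Q → α → M) :
    Q → List α → M
  | _, [] => 0
  | q, a :: σ => out q a + transducerOutput step out (step q a) σ

theorem map_transducerOutput {Q α M N : Type*} [AddCommMonoid M] [AddCommMonoid N]
    (f : M →+ N) (step : Q → α → Q) (out : Q → α → M) (q : Q) (σ : List α) :
    f (transducerOutput step out q σ) = transducerOutput step (fun q a => f (out q a)) q σ := by
  induction σ generalizing q with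
  | nil => exact map_zero f
  | cons a σ ih => simp only [transducerOutput, map_add, ih]

/-- A form of Parikh's theorem: the outputs of a finite transducer on a regular language form a
semilinear set. -/
theorem isSemilinearSet_transducerOutput {Q α M : Type*} [Finite Q] [Finite α] [AddCommMonoid M]
    (step : Q → α → Q) (out : Q → α → M) (p q : Q) :
    IsSemilinearSet {m | ∃ σ : List α, σ.foldl step p = q ∧ transducerOutput step out p σ = m} := by
  let E : Q → Q → Set M := fun p q => {m | ∃ a, step p a = q ∧ out p a = m}
  have hE : ∀ p q, IsSemilinearSet (E p q) := fun p q =>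
    .of_finite ((Set.finite_range (out p)).subset (by rintro _ ⟨a, -, rfl⟩; exact ⟨a, rfl⟩))
  -- Walks are nonempty, so the empty word is accounted for separately.
  have hzero : IsSemilinearSet {m : M | p = q ∧ m = 0} :=
    .of_finite ((Set.finite_singleton 0).subset fun m hm => hm.2)
  convert hzero.union (LabelledWalk.isSemilinearSet hE Set.finite_univ p q) using 1
  ext m
  constructor
  · rintro ⟨σ, rfl, rfl⟩
    clear hzero
    induction σ generalizing p with
    | nil => exact Or.inl ⟨rfl, rfl⟩
    | cons a σ ih =>
      right
      rcases ih (step p a) with ⟨h₁, h₂⟩ | h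
      · simp only [transducerOutput, List.foldl_cons, h₂, add_zero, ← h₁]
        exact .single ⟨a, rfl, rfl⟩
      · exact .cons ⟨a, rfl, rfl⟩ trivial h
  · rintro (⟨rfl, rfl⟩ | h)
    · exact ⟨[], rfl, rfl⟩
    · change LabelledWalk E Set.univ p q m at h
      clear hzero
      induction h with
      | single h =>
        obtain ⟨a, rfl, rfl⟩ := h
        exact ⟨[a], rfl, add_zero _⟩
      | cons h _ _ ih =>
        obtain ⟨a, rfl, rfl⟩ := h
        obtain ⟨σ, rfl, rfl⟩ := ih
        exact ⟨a :: σ, rfl, rfl⟩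

/-! ### Blind counters recognize semilinear conditions -/

theorem IsSemilinearSet.exists_fin_iUnion {M : Type*} [AddCommMonoid M] {s : Set M}
    (hs : IsSemilinearSet s) :
    ∃ (n : ℕ) (b : Fin n → M) (P : Fin n → Set M), (∀ i, (P i).Finite) ∧
      s = ⋃ i, {m | ∃ c ∈ AddSubmonoid.closure (P i), m = b i + c} := by
  obtain ⟨T, hT, hlin, rfl⟩ := hs
  obtain ⟨n, f, -, rfl⟩ := hT.fin_param
  choose b P hP hf using fun i => hlin (f i) ⟨i, rfl⟩
  refine ⟨n, b, P, hP, ?_⟩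
  rw [Set.sUnion_range]
  refine Set.iUnion_congr fun i => ?_
  rw [hf i]
  ext m
  simp [Set.mem_vadd_set, eq_comm]

/-- The automaton that runs a deterministic transducer with outputs in `ℤ ^ k` and, at the end of
the tape, subtracts from the counters the base vector `b q i` and arbitrarily many of the period
vectors in `P q i`, for some `i`, where `q` is the last state of the transducer. -/
def semilinearAcceptor {k n : ℕ} {α : Type*} [Finite α] (step : Fin n → α → Fin n)
    (out : Fin n → α → Fin k → ℤ) (q₀ : Fin n) (N : Fin n → ℕ)
    (b : ∀ q, Fin (N q) → Fin k → ℤ) (P : ∀ q, Fin (N q) → Set (Fin k → ℤ))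
    (hP : ∀ q i, (P q i).Finite) :
    BlindCounterAutomaton k α (Fin n ⊕ Σ q, Fin (N q)) where
  finite_alphabet := inferInstance
  finite_states := inferInstance
  δ := Set.range (fun x : Fin n × α =>
        ((.inl x.1, .letter x.2), (.inl (step x.1 x.2), out x.1 x.2))) ∪
      Set.range (fun j : Σ q, Fin (N q) =>
        ((.inl j.1, .endOfTape), (.inr j, -b j.1 j.2))) ∪
      ⋃ j : Σ q, Fin (N q), (fun v => ((.inr j, .endOfTape), (.inr j, -v))) '' P j.1 j.2
  finite_δ := ((Set.finite_range _).union (Set.finite_range _)).union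
    (Set.finite_iUnion fun j => (hP j.1 j.2).image _)
  start := .inl q₀
  final := Set.range .inr

section semilinearAcceptor

open Relation BlindCounterAutomaton

variable {k n : ℕ} {α : Type*} [Finite α] {step : Fin n → α → Fin n}
    {out : Fin n → α → Fin k → ℤ} {q₀ : Fin n} {N : Fin n → ℕ}
    {b : ∀ q, Fin (N q) → Fin k → ℤ} {P : ∀ q, Fin (N q) → Set (Fin k → ℤ)}
    {hP : ∀ q i, (P q i).Finite}

theorem semilinearAcceptor_reaches_read (q : Fin n) (c : Fin k → ℤ) (σ : List α) :
    (semilinearAcceptor step out q₀ N b P hP).Reaches ⟨.inl q, c, σ⟩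
      ⟨.inl (σ.foldl step q), c + transducerOutput step out q σ, []⟩ := by
  induction σ generalizing q c with
  | nil =>
    rw [transducerOutput, add_zero]
    exact ReflTransGen.refl
  | cons a σ ih =>
    refine ReflTransGen.head (Step.letter _ (.inl (step q a)) (out q a) c a σ
      (Or.inl (Or.inl ⟨(q, a), rfl⟩))) ?_
    rw [transducerOutput, ← add_assoc]
    exact ih (step q a) (c + out q a)

theorem semilinearAcceptor_reaches_periods (j : Σ q, Fin (N q)) {c : Fin k → ℤ}
    (hc : c ∈ AddSubmonoid.closure (P j.1 j.2)) (d : Fin k → ℤ) :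
    (semilinearAcceptor step out q₀ N b P hP).Reaches ⟨.inr j, d + c, []⟩ ⟨.inr j, d, []⟩ := by
  induction hc using AddSubmonoid.closure_induction generalizing d with
  | mem v hv =>
    refine ReflTransGen.single ?_
    have := Step.endOfTape (M := semilinearAcceptor step out q₀ N b P hP) (.inr j) (.inr j) (-v)
      (d + v) (Or.inr (Set.mem_iUnion.2 ⟨j, v, hv, rfl⟩))
    rwa [add_neg_cancel_right] at this
  | zero => rw [add_zero]; exact ReflTransGen.refl
  | add v w _ _ ihv ihw => rw [← add_assoc]; exact (ihw (d + v)).trans (ihv d)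

/-- An invariant of accepting runs, proved backwards from the final configuration: the counters plus
the output still to come must equal what is still to be subtracted. -/
theorem semilinearAcceptor_accepts_from {x : Config k α (Fin n ⊕ Σ q, Fin (N q))}
    {j : Σ q, Fin (N q)}
    (h : (semilinearAcceptor step out q₀ N b P hP).Reaches x ⟨.inr j, 0, []⟩) :
    match x with
    | ⟨.inl q, c, σ⟩ => ∃ i, ∃ d ∈ AddSubmonoid.closure (P (σ.foldl step q) i),
        c + transducerOutput step out q σ = b (σ.foldl step q) i + d
    | ⟨.inr j, c, _⟩ => c ∈ AddSubmonoid.closure (P j.1 j.2) := by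
  induction h using ReflTransGen.head_induction_on with
  | refl => exact zero_mem _
  | head hs _ ih =>
    cases hs with
    | letter q p v c a σ h =>
      rcases h with (⟨⟨q, a⟩, h⟩ | ⟨j, h⟩) | h
      · simp only [Prod.mk.injEq, InputLabel.letter.injEq] at h
        obtain ⟨⟨rfl, rfl⟩, rfl, rfl⟩ := h
        simpa only [transducerOutput, List.foldl_cons, add_assoc] using ih
      · simp at h
      · simp at h
    | empty q p v c σ h =>
      rcases h with (⟨⟨q, a⟩, h⟩ | ⟨j, h⟩) | h <;> simp at h
    | endOfTape q p v c h =>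
      rcases h with (⟨⟨q, a⟩, h⟩ | ⟨⟨q, i⟩, h⟩) | h
      · simp at h
      · simp only [Prod.mk.injEq, and_true] at h
        obtain ⟨rfl, rfl, rfl⟩ := h
        exact ⟨i, _, ih, by simp [transducerOutput]⟩
      · obtain ⟨j, w, hw, h⟩ := Set.mem_iUnion.1 h
        simp only [Prod.mk.injEq, and_true] at h
        obtain ⟨rfl, rfl, rfl⟩ := h
        have := add_mem ih (AddSubmonoid.subset_closure hw)
        simpa only [neg_add_cancel_right] using this

theorem semilinearAcceptor_language :
    (semilinearAcceptor step out q₀ N b P hP).language =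
      {σ | ∃ i, ∃ d ∈ AddSubmonoid.closure (P (σ.foldl step q₀) i),
        transducerOutput step out q₀ σ = b (σ.foldl step q₀) i + d} := by
  ext σ
  constructor
  · rintro ⟨_, ⟨j, rfl⟩, h⟩
    obtain ⟨i, d, hd, h⟩ := semilinearAcceptor_accepts_from h
    exact ⟨i, d, hd, by rw [← h, zero_add]⟩
  · rintro ⟨i, d, hd, h⟩
    refine ⟨.inr ⟨_, i⟩, ⟨_, rfl⟩, (semilinearAcceptor_reaches_read q₀ 0 σ).trans
      (ReflTransGen.head (Step.endOfTape _ (.inr ⟨_, i⟩) _ _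
        (Or.inl (Or.inr ⟨⟨_, i⟩, rfl⟩))) ?_)⟩
    have := semilinearAcceptor_reaches_periods (step := step) (out := out) (q₀ := q₀) (b := b)
      (hP := hP) ⟨_, i⟩ hd 0
    rw [zero_add] at this
    rwa [zero_add, h, add_neg_cancel_comm]

end semilinearAcceptor

/-- A language is blind multicounter if it consists of the words on which the output of a finite
transducer, in any commutative monoid, lies in a semilinear set depending on the last state. -/
theorem isBlindMulticounter_of_isSemilinearSet {n : ℕ} {α M : Type*} [Finite α] [AddCommMonoid M]
    (step : Fin n → α → Fin n) (out : Fin n → α → M) (q₀ : Fin n) (C : Fin n → Set M)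
    (hC : ∀ q, IsSemilinearSet (C q)) :
    IsBlindMulticounter
      ({σ | transducerOutput step out q₀ σ ∈ C (σ.foldl step q₀)} : Language α) := by
  classical
  -- One counter per pair of state and letter; `f` recovers the output in `M` from the number of
  -- uses of each pair.
  obtain ⟨k, ⟨e⟩⟩ := Finite.exists_equiv_fin (Fin n × α)
  let f : (Fin k → ℕ) →+ M :=
    { toFun := fun v => ∑ i, v i • out (e.symm i).1 (e.symm i).2
      map_zero' := by simp
      map_add' := fun v w => by simp [add_smul, Finset.sum_add_distrib] }
  let g : (Fin k → ℕ) →+ (Fin k → ℤ) := (Nat.castAddMonoidHom ℤ).compLeft (Fin k)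
  have hg : Function.Injective g := fun v w h => funext fun i => by
    simpa [g] using congrFun h i
  let count : Fin n → α → Fin k → ℕ := fun q a => Pi.single (e (q, a)) 1
  have hf : ∀ q a, f (count q a) = out q a := fun q a => by
    simp only [f, count, AddMonoidHom.coe_mk, ZeroHom.coe_mk]
    rw [Finset.sum_eq_single (e (q, a))] <;> simp +contextual
  -- Pulling back along `f` replaces `M`, which may have torsion, by vectors of counts; `g` embeds
  -- these in `ℤ ^ k`.
  have hD : ∀ q, IsSemilinearSet (g '' (f ⁻¹' C q)) := fun q => ((hC q).preimage f).image g
  choose N b P hP hN using fun q => (hD q).exists_fin_iUnion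
  refine ⟨k, _, semilinearAcceptor step (fun q a => g (count q a)) q₀ N b P hP, ?_⟩
  rw [semilinearAcceptor_language]
  ext σ
  have h₁ := congrArg (transducerOutput step (fun q a => g (count q a)) q₀ σ ∈ ·)
    (hN (σ.foldl step q₀))
  rw [← map_transducerOutput, hg.mem_set_image, Set.mem_preimage, map_transducerOutput] at h₁
  simp only [hf, Set.mem_iUnion, Set.mem_ofPred_eq, map_transducerOutput] at h₁
  exact (iff_of_eq h₁).symm

/-! ### Geodesics -/

namespace WeightedWord

variable {G : Type*} [Group G] {S : Finset G}

theorem isGeodesic_iff (ω : S → ℕ) (σ : List S) :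
    IsGeodesic ω σ ↔ ∀ τ : List S, value τ = value σ → weight ω σ ≤ weight ω τ := by
  constructor
  · intro h τ hτ
    exact h.trans_le (Nat.sInf_le ⟨τ, hτ, rfl⟩)
  · intro h
    refine le_antisymm ?_ (Nat.sInf_le ⟨σ, rfl, rfl⟩)
    obtain ⟨τ, hτ, hw⟩ := Nat.sInf_mem (s := {n : ℕ | ∃ τ : List S, value τ = value σ ∧
      weight ω τ = n}) ⟨_, σ, rfl, rfl⟩
    exact (h τ hτ).trans_eq hw

/-- If the value and the weight of words are computed by a finite transducer with outputs in a
commutative monoid, then the language of geodesics is blind multicounter. -/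
theorem isBlindMulticounter_geodesicLanguage_of_transducer {n : ℕ} {M : Type*} [AddCommMonoid M]
    (ω : S → ℕ) (step : Fin n → S → Fin n) (out : Fin n → S → M) (q₀ : Fin n)
    (h : ∀ σ τ : List S, value σ = value τ ↔ σ.foldl step q₀ = τ.foldl step q₀ ∧
      transducerOutput step out q₀ σ = transducerOutput step out q₀ τ) :
    IsBlindMulticounter (geodesicLanguage ω) := by
  let out' : Fin n → S → M × ℕ := fun q s => (out q s, ω s)
  have hfst : ∀ σ, (transducerOutput step out' q₀ σ).1 = transducerOutput step out q₀ σ :=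
    fun σ => map_transducerOutput (AddMonoidHom.fst M ℕ) step out' q₀ σ
  have hsnd : ∀ q σ, (transducerOutput step out' q σ).2 = weight ω σ := fun q σ => by
    induction σ generalizing q with
    | nil => rfl
    | cons a σ ih => simp [transducerOutput, weight, ih, out']
  let R : Fin n → Set (M × ℕ) := fun q =>
    {m | ∃ σ : List S, σ.foldl step q₀ = q ∧ transducerOutput step out' q₀ σ = m}
  let U : Set (M × ℕ) := {m | m.1 = 0 ∧ 0 < m.2}
  have hU : IsSemilinearSet U := by
    have : IsSemilinearSet {m : ℕ | 0 < m} := by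
      rw [Nat.isSemilinearSet_iff_ultimately_periodic]
      exact ⟨1, 1, one_pos, fun x hx => by simp; omega⟩
    convert this.image (AddMonoidHom.inr M ℕ) using 1
    ext ⟨a, m⟩
    simp [U, eq_comm, and_comm]
  have hR : ∀ q, IsSemilinearSet (R q) := isSemilinearSet_transducerOutput step out' q₀
  -- Every word has its output in `R`, so the difference only expresses a complement; the whole
  -- monoid `M × ℕ` need not be semilinear.
  suffices hL : geodesicLanguage ω = {σ : List S | transducerOutput step out' q₀ σ ∈
      R (σ.foldl step q₀) \ (R (σ.foldl step q₀) + U)} by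
    rw [hL]
    exact isBlindMulticounter_of_isSemilinearSet step out' q₀ (fun q => R q \ (R q + U))
      (fun q => (hR q).sdiff ((hR q).add hU))
  ext σ
  change IsGeodesic ω σ ↔ transducerOutput step out' q₀ σ ∈ R _ \ (R _ + U)
  rw [isGeodesic_iff, Set.mem_sdiff, and_iff_right ⟨σ, rfl, rfl⟩]
  constructor
  · rintro hσ ⟨_, ⟨τ, hτ, rfl⟩, u, ⟨hu, hu'⟩, hadd⟩
    have h₁ := congrArg Prod.fst hadd
    have h₂ := congrArg Prod.snd hadd
    simp only [Prod.fst_add, Prod.snd_add, hfst, hsnd, hu, add_zero] at h₁ h₂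
    have := hσ τ ((h τ σ).2 ⟨hτ, h₁⟩)
    omega
  · intro hσ τ hτ
    by_contra! hlt
    obtain ⟨hstep, hout⟩ := (h τ σ).1 hτ
    refine hσ ⟨_, ⟨τ, hstep, rfl⟩, (0, weight ω σ - weight ω τ), ⟨rfl, by simpa using hlt⟩, ?_⟩
    ext
    · simp [hfst, hout]
    · simp only [Prod.snd_add, hsnd]
      omega

end WeightedWord

theorem mainTheorem2 {G : Type*} [Group G] (hG : IsVirtuallyAbelian G)
    (S : Finset G) (hS : Submonoid.closure (S : Set G) = ⊤)
    (ω : S → ℕ) (hω : ∀ s, 0 < ω s) :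
    IsBlindMulticounter (WeightedWord.geodesicLanguage ω) := by
  obtain ⟨A, hA, hcomm⟩ := hG
  let N := A.normalCore
  obtain ⟨n, ⟨e⟩⟩ := Finite.exists_equiv_fin (G ⧸ N)
  let rep : Fin n → G := fun q => (e.symm q).out
  have hrep : ∀ q, ((rep q : G) : G ⧸ N) = e.symm q := fun q => Quotient.out_eq' _
  let step : Fin n → S → Fin n := fun q s => e (e.symm q * ((s : G) : G ⧸ N))
  let _ : CommGroup N := { (inferInstance : Group N) with
    mul_comm := fun x y => Subtype.ext
      (hcomm x (A.normalCore_le x.2) y (A.normalCore_le y.2)) }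
  have hmem : ∀ q (s : S), rep q * s * (rep (step q s))⁻¹ ∈ N := fun q s => by
    rw [← QuotientGroup.eq_one_iff]
    simp [hrep, step]
  let out : Fin n → S → Additive N := fun q s => .ofMul ⟨_, hmem q s⟩
  have hstep : ∀ q (σ : List S), σ.foldl step q = e (e.symm q * ((WeightedWord.value σ : G) : G ⧸ N)) := by
    intro q σ
    induction σ generalizing q with
    | nil => simp [WeightedWord.value]
    | cons a σ ih => simp [ih, step, WeightedWord.value, mul_assoc]
  -- The Schreier elements telescope. The representative of the initial coset need not be `1`, but
  -- it cancels when two words are compared.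
  have hval : ∀ q (σ : List S), rep q * WeightedWord.value σ =
      ((transducerOutput step out q σ).toMul : G) * rep (σ.foldl step q) := by
    intro q σ
    induction σ generalizing q with
    | nil => simp [WeightedWord.value, transducerOutput]
    | cons a σ ih =>
      have hcons : WeightedWord.value (a :: σ) = a * WeightedWord.value σ := by simp [WeightedWord.value]
      have hout : ((transducerOutput step out q (a :: σ)).toMul : G) =
          rep q * a * (rep (step q a))⁻¹ * (transducerOutput step out (step q a) σ).toMul := rfl
      rw [hcons, hout, List.foldl_cons, mul_assoc _ _ (rep _), ← ih]
      group
  refine WeightedWord.isBlindMulticounter_geodesicLanguage_of_transducer ω step out (e 1) fun σ τ => ?_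
  constructor
  · intro h
    have hq : σ.foldl step (e 1) = τ.foldl step (e 1) := by rw [hstep, hstep, h]
    refine ⟨hq, Additive.toMul.injective (Subtype.ext ?_)⟩
    have := hval (e 1) σ
    rw [h, hval (e 1) τ, hq] at this
    exact (mul_right_cancel this).symm
  · rintro ⟨hq, hout⟩
    have := hval (e 1) σ
    rw [hq, hout, ← hval] at this
    exact mul_left_cancel this
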